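/- Let $H,K$ be complex Hilbert spaces and let $\mathcal S\subseteq B(H)$ and $\mathcal T\subseteq B(K)$ be $w^*$-closed operator systems, i.e. $w^*$-closed self-adjoint linear subspaces containing the identity operator. Suppose that $\mathcal S$ and $\mathcal T$ are TRO-equivalent as dual operator systems: there is a linear subspace $\mathcal M\subseteq B(H,K)$ with $\mathcal M\mathcal M^*\mathcal M\subseteq\mathcal M$ (a ternary ring of operators) such that $$[\mathcal M\mathcal S\mathcal M^*]^{-w^*}=\mathcal T\quad\text{and}\quad[\mathcal M^*\mathcal T\mathcal M]^{-w^*}=\mathcal S,$$ where $[\,\cdot\,]^{-w^*}$ denotes the $w^*$-closed linear span of the set of all products. Then there exist a nonzero cardinal $J$ and a unitary operator $U$ from $H\otimes\ell^2_J$ onto $K\otimes\ell^2_J$ such that $$\mathcal T\,\bar\otimes\, M_J=U(\mathcal S\,\bar\otimes\, M_J)U^*.$$ Here $\otimes$ between Hilbert spaces is the Hilbert space tensor product, $M_J=B(\ell^2_J)$, and for a $w^*$-closed subspace $\mathcal X\subseteq B(H)$, $\mathcal X\,\bar\otimes\, M_J$ is the $w^*$-closed linear span in $B(H\otimes\ell^2_J)$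 of the operators $x\otimes y$ with $x\in\mathcal X$, $y\in M_J$ (similarly for $K$). -/

import Mathlib

open scoped TensorProduct lp Topology

universe u v

noncomputable section

/-- The `σ`-weak (ultraweak, i.e. w*-) topology on `B(H, K)`: the coarsest topology for which all
functionals `T ↦ ∑ n, ⟪η n, T (ξ n)⟫` with square-summable sequences `ξ` in `H` and `η` in `K` are
continuous. It is the weak* topology coming from the trace-class predual. -/
@[reducible]
def sigmaWeakTopology (H K : Type*)
    [NormedAddCommGroup H] [InnerProductSpace ℂ H]
    [NormedAddCommGroup K] [InnerProductSpace ℂ K] : TopologicalSpace (H →L[ℂ] K) :=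
  TopologicalSpace.induced
    (fun (T : H →L[ℂ] K) (p : ℓ²(ℕ, H) × ℓ²(ℕ, K)) => ∑' n, inner ℂ (p.2 n) (T (p.1 n)))
    inferInstance

/-- The series defining the functionals of the `σ`-weak topology always converge (absolutely). -/
theorem summable_sigmaWeak_functional {H K : Type*}
    [NormedAddCommGroup H] [InnerProductSpace ℂ H]
    [NormedAddCommGroup K] [InnerProductSpace ℂ K]
    (T : H →L[ℂ] K) (ξ : ℓ²(ℕ, H)) (η : ℓ²(ℕ, K)) :
    Summable fun n => inner ℂ (η n) (T (ξ n)) := by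
  have hξ : Summable fun n => ‖ξ n‖ ^ 2 := by
    simpa using (memℓp_gen_iff (p := 2) (by norm_num)).1 (lp.memℓp ξ)
  have hη : Summable fun n => ‖η n‖ ^ 2 := by
    simpa using (memℓp_gen_iff (p := 2) (by norm_num)).1 (lp.memℓp η)
  refine Summable.of_norm_bounded ((hη.add hξ).mul_left ‖T‖) fun n => ?_
  calc ‖inner ℂ (η n) (T (ξ n))‖ ≤ ‖η n‖ * ‖T (ξ n)‖ := norm_inner_le_norm _ _
    _ ≤ ‖η n‖ * (‖T‖ * ‖ξ n‖) := by gcongr; exact T.le_opNorm _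
    _ = ‖T‖ * (‖η n‖ * ‖ξ n‖) := by ring
    _ ≤ ‖T‖ * (‖η n‖ ^ 2 + ‖ξ n‖ ^ 2) := by
      gcongr
      nlinarith [sq_nonneg (‖η n‖ - ‖ξ n‖), sq_nonneg ‖η n‖, sq_nonneg ‖ξ n‖]

/-- `[A]^{-w*}`: the w*-closed linear span of a set `A` of operators. -/
def wStarSpan {H K : Type*}
    [NormedAddCommGroup H] [InnerProductSpace ℂ H]
    [NormedAddCommGroup K] [InnerProductSpace ℂ K]
    (A : Set (H →L[ℂ] K)) : Set (H →L[ℂ] K) :=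
  @closure _ (sigmaWeakTopology H K) (Submodule.span ℂ A : Set (H →L[ℂ] K))

/-- A w*-closed (concrete, unital) operator system `S ⊆ B(H)`: a self-adjoint, w*-closed linear
subspace containing the identity. -/
structure IsWStarClosedOperatorSystem {H : Type*}
    [NormedAddCommGroup H] [InnerProductSpace ℂ H] [CompleteSpace H]
    (S : Submodule ℂ (H →L[ℂ] H)) : Prop where
  one_mem : ContinuousLinearMap.id ℂ H ∈ S
  adjoint_mem : ∀ s ∈ S, ContinuousLinearMap.adjoint s ∈ S
  wStarClosed : @IsClosed _ (sigmaWeakTopology H H) (S : Set (H →L[ℂ] H))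

/-- A ternary ring of operators: a linear subspace `M ⊆ B(H, K)` with `M M* M ⊆ M`. -/
def IsTRO {H K : Type*}
    [NormedAddCommGroup H] [InnerProductSpace ℂ H] [CompleteSpace H]
    [NormedAddCommGroup K] [InnerProductSpace ℂ K] [CompleteSpace K]
    (M : Submodule ℂ (H →L[ℂ] K)) : Prop :=
  ∀ a ∈ M, ∀ b ∈ M, ∀ c ∈ M, a ∘L ContinuousLinearMap.adjoint b ∘L c ∈ M

/-- TRO-equivalence of operator systems `S ⊆ B(H)` and `T ⊆ B(K)`: there is a single TRO
`M ⊆ B(H, K)` with `[M S M*]^{-w*} = T` and `[M* T M]^{-w*} = S`. -/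
def TROEquivalent {H K : Type*}
    [NormedAddCommGroup H] [InnerProductSpace ℂ H] [CompleteSpace H]
    [NormedAddCommGroup K] [InnerProductSpace ℂ K] [CompleteSpace K]
    (S : Submodule ℂ (H →L[ℂ] H)) (T : Submodule ℂ (K →L[ℂ] K)) : Prop :=
  ∃ M : Submodule ℂ (H →L[ℂ] K), IsTRO M ∧
    wStarSpan {x : K →L[ℂ] K | ∃ m ∈ M, ∃ s ∈ S, ∃ n ∈ M,
      x = m ∘L s ∘L ContinuousLinearMap.adjoint n} = (T : Set (K →L[ℂ] K)) ∧
    wStarSpan {x : H →L[ℂ] H | ∃ m ∈ M, ∃ t ∈ T, ∃ n ∈ M,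
      x = ContinuousLinearMap.adjoint m ∘L t ∘L n} = (S : Set (H →L[ℂ] H))

/-- The Hilbert space tensor product: the completion of the algebraic tensor product for the inner
product `⟪a ⊗ b, c ⊗ d⟫ = ⟪a, c⟫ ⟪b, d⟫`. -/
abbrev HilbertTensor (H L : Type*)
    [NormedAddCommGroup H] [InnerProductSpace ℂ H]
    [NormedAddCommGroup L] [InnerProductSpace ℂ L] : Type _ :=
  UniformSpace.Completion (H ⊗[ℂ] L)

/-- The operator `x ⊗ y` on the Hilbert space tensor product. -/
def opTensor {H L : Type*}
    [NormedAddCommGroup H] [InnerProductSpace ℂ H]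
    [NormedAddCommGroup L] [InnerProductSpace ℂ L]
    (x : H →L[ℂ] H) (y : L →L[ℂ] L) : HilbertTensor H L →L[ℂ] HilbertTensor H L :=
  (TensorProduct.mapL x y).completion

/-- `(x ⊗ y)(ξ ⊗ η) = x ξ ⊗ y η`. -/
theorem opTensor_tmul {H L : Type*}
    [NormedAddCommGroup H] [InnerProductSpace ℂ H]
    [NormedAddCommGroup L] [InnerProductSpace ℂ L]
    (x : H →L[ℂ] H) (y : L →L[ℂ] L) (ξ : H) (η : L) :
    opTensor x y ((ξ ⊗ₜ[ℂ] η : H ⊗[ℂ] L) : HilbertTensor H L) =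
      ((x ξ ⊗ₜ[ℂ] y η : H ⊗[ℂ] L) : HilbertTensor H L) :=
  ContinuousLinearMap.completion_apply_coe _ _

/-- The normal spatial tensor product `X ⊗̄ Y` of subspaces `X ⊆ B(H)`, `Y ⊆ B(L)`: the w*-closed
linear span in `B(H ⊗ L)` of the elementary tensors `x ⊗ y`. -/
def normalSpatialTensor {H L : Type*}
    [NormedAddCommGroup H] [InnerProductSpace ℂ H]
    [NormedAddCommGroup L] [InnerProductSpace ℂ L]
    (X : Submodule ℂ (H →L[ℂ] H)) (Y : Submodule ℂ (L →L[ℂ] L)) :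
    Set (HilbertTensor H L →L[ℂ] HilbertTensor H L) :=
  wStarSpan {z | ∃ x ∈ X, ∃ y ∈ Y, z = opTensor x y}

/-- `M_J`, the space of all `J × J` matrices that define bounded operators, realized as the full
operator space `B(ℓ²_J)`. -/
def matrixSpace (J : Type*) : Submodule ℂ (ℓ²(J, ℂ) →L[ℂ] ℓ²(J, ℂ)) := ⊤

end

/-! Let R be the set of pairs (a, b) with m a = b m and m a* = b* m for all m in M
(`linkingCommutant`). The theorem rests on two facts about operators intertwining R.

First, as in the double commutant theorem, if w : K → H satisfies w b = a w on R, then on each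
square-summable sequence w is a limit of adjoints of elements of M
(`ampliation_mem_closure_adjoint`). Since M S M* ⊆ T and T is w*-closed, u* x v lies in T whenever
u, v : K → ℓ²(J, H) intertwine R and x is a matrix with entries in S (`adjoint_comp_comp_mem`).

Second, ℓ²(J, H) and ℓ²(J, K) are unitarily equivalent over R for large J. The identities in S and T
force M to be nondegenerate on both sides, so intertwiners separate points; Zorn's lemma gives
intertwiners vᵢ with ∑ vᵢ* vᵢ = 1 (`exists_intertwining_column`). If J absorbs the index set, these
give isometric intertwiners in both directions, and `exists_unitary_intertwiner` turns them into a
unitary U.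

Finally, S ⊗̄ M_J is the space of matrices with entries in S, and the entries of U x U* have the
form u* x v with u, v columns of U*. So U carries S ⊗̄ M_J into T ⊗̄ M_J; the same argument for M*
and U* gives the reverse inclusion. -/

open ContinuousLinearMap Filter

noncomputable section

/-! ### Ampliations and coordinates of ℓ²(ι, H) -/

section Ampliation

variable {ι H K L : Type*}
  [NormedAddCommGroup H] [InnerProductSpace ℂ H]
  [NormedAddCommGroup K] [InnerProductSpace ℂ K]
  [NormedAddCommGroup L] [InnerProductSpace ℂ L]

omit [InnerProductSpace ℂ H] in
theorem lp_hasSum_norm_sq (f : ℓ²(ι, H)) : HasSum (fun i => ‖f i‖ ^ 2) (‖f‖ ^ 2) := by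
  simpa using lp.hasSum_norm (p := 2) (by norm_num) f

omit [InnerProductSpace ℂ H] in
theorem memℓp_two_of_summable {f : ι → H} (hf : Summable fun i => ‖f i‖ ^ 2) : Memℓp f 2 :=
  memℓp_gen (by simpa using hf)

theorem summable_norm_sq_map (x : H →L[ℂ] K) (f : ℓ²(ι, H)) : Summable fun i => ‖x (f i)‖ ^ 2 :=
  .of_nonneg_of_le (fun _ => by positivity)
    (fun i => by rw [← mul_pow]; gcongr; exact x.le_opNorm _)
    ((lp_hasSum_norm_sq f).summable.mul_left (‖x‖ ^ 2))

/-- The diagonal ampliation of `x` to square-summable families. -/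
def ampliation (ι : Type*) (x : H →L[ℂ] K) : ℓ²(ι, H) →L[ℂ] ℓ²(ι, K) :=
  LinearMap.mkContinuous
    { toFun := fun f => ⟨fun i => x (f i), memℓp_two_of_summable (summable_norm_sq_map x f)⟩
      map_add' := fun f g => Subtype.ext (funext fun i => x.map_add (f i) (g i))
      map_smul' := fun c f => Subtype.ext (funext fun i => x.map_smul c (f i)) } ‖x‖ fun f => by
    refine le_of_sq_le_sq ?_ (by positivity)
    rw [mul_pow]
    refine hasSum_le (fun i => ?_) (lp_hasSum_norm_sq _) ((lp_hasSum_norm_sq f).mul_left _)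
    rw [← mul_pow]
    gcongr
    exact x.le_opNorm _

@[simp] theorem ampliation_apply (x : H →L[ℂ] K) (f : ℓ²(ι, H)) (i : ι) :
    ampliation ι x f i = x (f i) := rfl

theorem ampliation_comp_apply (x : K →L[ℂ] L) (y : H →L[ℂ] K) (f : ℓ²(ι, H)) :
    ampliation ι (x ∘L y) f = ampliation ι x (ampliation ι y f) := by
  ext; simp

theorem ampliation_add (x y : H →L[ℂ] K) :
    ampliation ι (x + y) = ampliation ι x + ampliation ι y := by
  ext; simp

theorem ampliation_smul (c : ℂ) (x : H →L[ℂ] K) :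
    ampliation ι (c • x) = c • ampliation ι x := by
  ext; simp

theorem adjoint_ampliation [CompleteSpace H] [CompleteSpace K] (x : H →L[ℂ] K) :
    adjoint (ampliation ι x) = ampliation ι (adjoint x) := by
  symm
  rw [eq_adjoint_iff]
  intro f g
  simp [lp.inner_eq_tsum, adjoint_inner_left]

theorem inner_ampliation_adjoint_comp [CompleteSpace K] [CompleteSpace L]
    (u : K →L[ℂ] L) (w : H →L[ℂ] L) (ξ : ℓ²(ι, H)) (η : ℓ²(ι, K)) :
    inner ℂ η (ampliation ι (adjoint u ∘L w) ξ) =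
      inner ℂ (ampliation ι u η) (ampliation ι w ξ) := by
  rw [ampliation_comp_apply, ← adjoint_ampliation, adjoint_inner_right]

/-- The inclusion of `H` as the `i`-th coordinate of `ℓ²(ι, H)`. -/
def lpCol (i : ι) : H →L[ℂ] ℓ²(ι, H) := by
  classical exact lp.singleContinuousLinearMap ℂ (fun _ : ι => H) 2 i

/-- The `i`-th coordinate of `ℓ²(ι, H)`. -/
def lpRow (i : ι) : ℓ²(ι, H) →L[ℂ] H := lp.evalCLM ℂ (fun _ : ι => H) 2 i

@[simp] theorem lpRow_apply (i : ι) (f : ℓ²(ι, H)) : lpRow i f = f i := rfl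

@[simp] theorem lpCol_apply_self (i : ι) (h : H) : lpCol i h i = h := by
  classical simp [lpCol]

theorem lpCol_apply_ne {i j : ι} (hij : j ≠ i) (h : H) : lpCol i h j = 0 := by
  classical simp [lpCol, hij]

theorem inner_lpCol_left (i : ι) (h : H) (f : ℓ²(ι, H)) :
    inner ℂ (lpCol i h) f = inner ℂ h (f i) := by
  classical simp [lpCol, lp.inner_single_left]

theorem adjoint_lpCol [CompleteSpace H] (i : ι) : adjoint (lpCol (H := H) i) = lpRow i := by
  symm
  rw [eq_adjoint_iff]
  intro f h
  rw [← inner_conj_symm, ← inner_conj_symm f, inner_lpCol_left, lpRow_apply]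

theorem adjoint_lpRow [CompleteSpace H] (i : ι) : adjoint (lpRow (H := H) i) = lpCol i := by
  rw [← adjoint_lpCol, adjoint_adjoint]

theorem ampliation_lpCol (x : H →L[ℂ] K) (i : ι) (h : H) :
    ampliation ι x (lpCol i h) = lpCol i (x h) := by
  ext j
  by_cases hj : j = i
  · subst hj; simp
  · simp [lpCol_apply_ne hj]

theorem hasSum_lpCol (f : ℓ²(ι, H)) : HasSum (fun i => lpCol i (f i)) f := by
  classical
  exact lp.hasSum_single (p := 2) (by simp) f

/-- Operators on `ℓ²(ι, H)` agree if they agree on all coordinate vectors. -/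
theorem ext_lpCol {x y : ℓ²(ι, H) →L[ℂ] K} (h : ∀ i, x ∘L lpCol i = y ∘L lpCol i) : x = y := by
  ext f
  refine ((hasSum_lpCol f).mapL x).unique ?_
  convert (hasSum_lpCol f).mapL y using 2 with i
  exact congr($(h i) (f i))

theorem ext_entries {x y : ℓ²(ι, H) →L[ℂ] ℓ²(ι, K)}
    (h : ∀ i j, lpRow i ∘L x ∘L lpCol j = lpRow i ∘L y ∘L lpCol j) : x = y :=
  ext_lpCol fun j => by
    ext f i
    exact congr($(h i j) f)

end Ampliation

/-! ### Normal functionals and the bipolar theorem for the w*-topology -/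

section Annihilator

variable {H K : Type*}
  [NormedAddCommGroup H] [InnerProductSpace ℂ H]
  [NormedAddCommGroup K] [InnerProductSpace ℂ K]

/-- The sequence `f 0, g 0, f 1, g 1, …`. -/
def interleave {M : Type*} (f g : ℕ → M) (n : ℕ) : M :=
  Sum.elim f g (Equiv.natSumNatEquivNat.symm n)

theorem hasSum_interleave {M : Type*} [AddCommMonoid M] [TopologicalSpace M] [ContinuousAdd M]
    {f g : ℕ → M} {a b : M} (hf : HasSum f a) (hg : HasSum g b) :
    HasSum (interleave f g) (a + b) :=
  (Equiv.hasSum_iff (f := Sum.elim f g) Equiv.natSumNatEquivNat.symm).2 (HasSum.sum hf hg)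

omit [InnerProductSpace ℂ H] in
theorem memℓp_interleave (f g : ℓ²(ℕ, H)) : Memℓp (interleave f g) 2 := by
  refine memℓp_two_of_summable ?_
  convert (hasSum_interleave (lp_hasSum_norm_sq f) (lp_hasSum_norm_sq g)).summable using 2 with n
  unfold interleave
  rcases Equiv.natSumNatEquivNat.symm n with m | m <;> rfl

/-- Interleaving the sequences adds the functionals. Hence a finite combination of normal
functionals is again given by one pair of sequences, and w*-closures can be tested one pair at a
time. -/
theorem exists_lp_sum_functional (ξ ξ' : ℓ²(ℕ, H)) (η η' : ℓ²(ℕ, K)) :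
    ∃ (ζ : ℓ²(ℕ, H)) (θ : ℓ²(ℕ, K)), ∀ x : H →L[ℂ] K,
      inner ℂ θ (ampliation ℕ x ζ) =
        inner ℂ η (ampliation ℕ x ξ) + inner ℂ η' (ampliation ℕ x ξ') := by
  refine ⟨⟨_, memℓp_interleave ξ ξ'⟩, ⟨_, memℓp_interleave η η'⟩, fun x => ?_⟩
  refine (lp.hasSum_inner _ _).unique ?_
  have h := hasSum_interleave (lp.hasSum_inner (𝕜 := ℂ) η (ampliation ℕ x ξ))
    (lp.hasSum_inner (𝕜 := ℂ) η' (ampliation ℕ x ξ'))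
  convert h using 2 with n
  simp only [ampliation_apply, interleave]
  rcases Equiv.natSumNatEquivNat.symm n with m | m <;> rfl

theorem exists_lp_functional_finset (I : Finset (ℓ²(ℕ, H) × ℓ²(ℕ, K)))
    (c : ℓ²(ℕ, H) × ℓ²(ℕ, K) → ℂ) :
    ∃ (ζ : ℓ²(ℕ, H)) (θ : ℓ²(ℕ, K)), ∀ x : H →L[ℂ] K,
      inner ℂ θ (ampliation ℕ x ζ) = ∑ p ∈ I, c p * inner ℂ p.2 (ampliation ℕ x p.1) := by
  classical
  induction I using Finset.induction_on with
  | empty => exact ⟨0, 0, fun x => by simp⟩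
  | insert p I hp ih =>
    obtain ⟨ζ, θ, h⟩ := ih
    obtain ⟨ζ', θ', h'⟩ := exists_lp_sum_functional (c p • p.1) ζ p.2 θ
    refine ⟨ζ', θ', fun x => ?_⟩
    rw [h', Finset.sum_insert hp, h, map_smul, inner_smul_right]

theorem sigmaWeak_functional_eq (x : H →L[ℂ] K) (ξ : ℓ²(ℕ, H)) (η : ℓ²(ℕ, K)) :
    ∑' n, inner ℂ (η n) (x (ξ n)) = inner ℂ η (ampliation ℕ x ξ) := by
  rw [lp.inner_eq_tsum]; rfl

/-- Bipolar description of the w*-closed linear span. -/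
theorem mem_wStarSpan_iff {A : Set (H →L[ℂ] K)} {x : H →L[ℂ] K} :
    x ∈ wStarSpan A ↔ ∀ (ξ : ℓ²(ℕ, H)) (η : ℓ²(ℕ, K)),
      (∀ a ∈ A, inner ℂ η (ampliation ℕ a ξ) = 0) → inner ℂ η (ampliation ℕ x ξ) = 0 := by
  let Φ : (H →L[ℂ] K) →ₗ[ℂ] (ℓ²(ℕ, H) × ℓ²(ℕ, K) → ℂ) :=
    { toFun := fun x p => inner ℂ p.2 (ampliation ℕ x p.1)
      map_add' := fun x y => by ext; simp [ampliation_add]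
      map_smul' := fun c x => by ext; simp [ampliation_smul] }
  have hmem : x ∈ wStarSpan A ↔ Φ x ∈ closure (Φ '' (Submodule.span ℂ A)) := by
    have hΦ : ⇑Φ = fun (T : H →L[ℂ] K) (p : ℓ²(ℕ, H) × ℓ²(ℕ, K)) =>
        ∑' n, inner ℂ (p.2 n) (T (p.1 n)) := by
      ext; exact (sigmaWeak_functional_eq _ _ _).symm
    rw [hΦ]
    exact closure_induced
  have hspan {ξ : ℓ²(ℕ, H)} {η : ℓ²(ℕ, K)} (h : ∀ a ∈ A, inner ℂ η (ampliation ℕ a ξ) = 0) :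
      ∀ a ∈ Submodule.span ℂ A, inner ℂ η (ampliation ℕ a ξ) = 0 := by
    have : Submodule.span ℂ A ≤ LinearMap.ker (LinearMap.proj (ξ, η) ∘ₗ Φ) :=
      Submodule.span_le.2 h
    exact this
  classical
  rw [hmem]
  constructor
  · intro hx ξ η h
    have hc : IsClosed {f : ℓ²(ℕ, H) × ℓ²(ℕ, K) → ℂ | f (ξ, η) = 0} :=
      isClosed_eq (continuous_apply _) continuous_const
    refine closure_minimal ?_ hc hx
    rintro _ ⟨a, ha, rfl⟩
    exact hspan h a ha
  · intro h
    rw [mem_closure_iff]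
    intro o ho hxo
    obtain ⟨I, w, hw, hI⟩ := isOpen_pi_iff.1 ho _ hxo
    -- A basic neighbourhood sees only the finitely many coordinates in I, so separation takes place
    -- in the finite-dimensional space I → ℂ.
    let R : (H →L[ℂ] K) →ₗ[ℂ] (I → ℂ) := LinearMap.pi fun p => LinearMap.proj p.1 ∘ₗ Φ
    have hR : R x ∈ (Submodule.span ℂ A).map R := by
      by_contra hx
      obtain ⟨f, hf, hker⟩ := Submodule.exists_le_ker_of_notMem hx
      obtain ⟨ζ, θ, hζ⟩ := exists_lp_functional_finset (H := H) (K := K) I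
        fun p => if hp : p ∈ I then f (Pi.single ⟨p, hp⟩ 1) else 0
      have hfR (y : H →L[ℂ] K) : f (R y) = inner ℂ θ (ampliation ℕ y ζ) := by
        rw [hζ, LinearMap.pi_apply_eq_sum_univ f, ← Finset.sum_coe_sort I]
        refine Finset.sum_congr rfl fun p _ => ?_
        rw [dif_pos p.2, smul_eq_mul, mul_comm]
        congr 2
        ext q
        simp [Pi.single_apply, eq_comm]
      refine hf ((hfR x).trans (h ζ θ fun a ha => ?_))
      rw [← hfR]
      exact hker (Submodule.mem_map_of_mem (Submodule.subset_span ha))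
    obtain ⟨a, ha, hax⟩ := hR
    refine ⟨Φ a, hI fun p hp => ?_, a, ha, rfl⟩
    have := congrFun hax ⟨p, hp⟩
    change Φ a p = Φ x p at this
    rw [this]
    exact (hw p hp).2

theorem subset_wStarSpan (A : Set (H →L[ℂ] K)) : A ⊆ wStarSpan A :=
  fun a ha => mem_wStarSpan_iff.2 fun _ _ h => h a ha

theorem mem_of_wStarClosed {S : Submodule ℂ (H →L[ℂ] K)}
    (hS : @IsClosed _ (sigmaWeakTopology H K) (S : Set (H →L[ℂ] K))) {x : H →L[ℂ] K}
    (hx : ∀ (ξ : ℓ²(ℕ, H)) (η : ℓ²(ℕ, K)),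
      (∀ s ∈ S, inner ℂ η (ampliation ℕ s ξ) = 0) → inner ℂ η (ampliation ℕ x ξ) = 0) :
    x ∈ S := by
  have h : x ∈ wStarSpan (S : Set (H →L[ℂ] K)) := mem_wStarSpan_iff.2 hx
  rw [wStarSpan, Submodule.span_eq, @IsClosed.closure_eq _ (sigmaWeakTopology H K) _ hS] at h
  exact h

end Annihilator

/-! ### Invariant subspaces and orbits -/

section Projections

variable {X Y : Type*}
  [NormedAddCommGroup X] [InnerProductSpace ℂ X] [CompleteSpace X]
  [NormedAddCommGroup Y] [InnerProductSpace ℂ Y] [CompleteSpace Y]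

/-- As x maps V into W and x* maps W into V, it also maps V⊥ into W⊥. -/
theorem comp_starProjection_eq (V : Submodule ℂ X) (W : Submodule ℂ Y)
    [V.HasOrthogonalProjection] [W.HasOrthogonalProjection] {x : X →L[ℂ] Y}
    (hx : ∀ v ∈ V, x v ∈ W) (hx' : ∀ w ∈ W, adjoint x w ∈ V) :
    x ∘L V.starProjection = W.starProjection ∘L x := by
  ext f
  refine (Submodule.eq_starProjection_of_mem_of_inner_eq_zero
    (hx _ (V.starProjection_apply_mem f)) fun w hw => ?_).symm
  change inner ℂ (x f - x (V.starProjection f)) w = 0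
  rw [← inner_conj_symm, ← x.map_sub, ← adjoint_inner_left, inner_conj_symm]
  exact V.starProjection_inner_eq_zero _ _ (hx' w hw)

omit [CompleteSpace X] [CompleteSpace Y] in
theorem map_mem_of_mem_closure_span {A : Set X} {W : Submodule ℂ Y} (hW : IsClosed (W : Set Y))
    {x : X →L[ℂ] Y} (h : ∀ a ∈ A, x a ∈ W) :
    ∀ v ∈ (Submodule.span ℂ A).topologicalClosure, x v ∈ W := by
  have : (Submodule.span ℂ A).topologicalClosure ≤ W.comap x.toLinearMap :=
    Submodule.topologicalClosure_minimal _ (Submodule.span_le.2 h) (hW.preimage x.continuous)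
  exact this

instance (V : Submodule ℂ X) : CompleteSpace V.topologicalClosure :=
  V.isClosed_topologicalClosure.completeSpace_coe

/-- A nondegenerate self-adjoint semigroup of operators recovers each vector from its orbit. -/
theorem mem_closure_span_orbit {A : Set (X →L[ℂ] X)}
    (hmul : ∀ a ∈ A, ∀ b ∈ A, a ∘L b ∈ A) (hstar : ∀ a ∈ A, adjoint a ∈ A)
    (hnd : ∀ g, (∀ a ∈ A, a g = 0) → g = 0) (f : X) :
    f ∈ (Submodule.span ℂ ((fun a => a f) '' A)).topologicalClosure := by
  set V := (Submodule.span ℂ ((fun a => a f) '' A)).topologicalClosure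
  have hmem : ∀ a ∈ A, a f ∈ V := fun a ha =>
    Submodule.le_topologicalClosure _ (Submodule.subset_span ⟨a, ha, rfl⟩)
  have hinv : ∀ a ∈ A, ∀ v ∈ V, a v ∈ V := fun a ha =>
    map_mem_of_mem_closure_span (Submodule.isClosed_topologicalClosure _) (by
      rintro _ ⟨b, hb, rfl⟩
      exact hmem _ (hmul a ha b hb))
  -- The projection onto V commutes with A, and A f ⊆ V, so A kills f minus its projection;
  -- nondegeneracy makes this difference zero.
  rw [← Submodule.starProjection_eq_self_iff]
  refine (sub_eq_zero.1 (hnd _ fun a ha => ?_)).symm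
  have h := congr($(comp_starProjection_eq V V (hinv a ha) (hinv _ (hstar a ha))) f)
  simp only [comp_apply] at h
  rw [map_sub, h, Submodule.starProjection_eq_self_iff.2 (hmem a ha), sub_self]

end Projections

/-! ### Testing normal functionals on matrix entries -/

section Entries

variable {ι J H : Type*} [NormedAddCommGroup H] [InnerProductSpace ℂ H] [CompleteSpace H]

theorem mem_closure_span_coordinates (f : ℓ²(ι, ℓ²(J, H))) :
    f ∈ (Submodule.span ℂ (Set.range fun k : J =>
      ampliation ι (lpCol k) (ampliation ι (lpRow k) f))).topologicalClosure := by
  have h := mem_closure_span_orbit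
    -- Zero is adjoined so that products of distinct coordinate projections stay in the set.
    (A := {a | a = 0 ∨ ∃ k : J, a = ampliation ι (lpCol (H := H) k ∘L lpRow k)}) ?_ ?_ ?_ f
  · refine Submodule.topologicalClosure_mono (Submodule.span_le.2 ?_) h
    rintro _ ⟨_, rfl | ⟨k, rfl⟩, rfl⟩
    · exact Submodule.zero_mem _
    · exact Submodule.subset_span ⟨k, (ampliation_comp_apply _ _ _).symm⟩
  · rintro _ (rfl | ⟨k, rfl⟩) _ (rfl | ⟨l, rfl⟩)
    · exact .inl (by simp)
    · exact .inl (by simp)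
    · exact .inl (by simp)
    · by_cases hkl : k = l
      · subst hkl
        refine .inr ⟨k, ?_⟩
        ext; simp
      · refine .inl ?_
        ext
        simp [lpCol_apply_ne hkl]
  · rintro _ (rfl | ⟨k, rfl⟩)
    · exact .inl (by simp)
    · exact .inr ⟨k, by rw [adjoint_ampliation, adjoint_comp, adjoint_lpCol, adjoint_lpRow]⟩
  · intro g hg
    ext i k
    simpa using congr($(hg _ (.inr ⟨k, rfl⟩)) i k)

theorem inner_eq_zero_of_mem_closure_span {X : Type*} [NormedAddCommGroup X] [InnerProductSpace ℂ X]
    {A B : Set X} (h : ∀ a ∈ A, ∀ b ∈ B, inner ℂ a b = 0) {x y : X}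
    (hx : x ∈ (Submodule.span ℂ A).topologicalClosure)
    (hy : y ∈ (Submodule.span ℂ B).topologicalClosure) : inner ℂ x y = 0 := by
  have h1 : ∀ a ∈ A, inner ℂ a y = 0 := fun a ha => by
    have : (Submodule.span ℂ B).topologicalClosure ≤ LinearMap.ker (innerSL ℂ a).toLinearMap :=
      Submodule.topologicalClosure_minimal _ (Submodule.span_le.2 (h a ha))
        (innerSL ℂ a).isClosed_ker
    exact this hy
  have : (Submodule.span ℂ A).topologicalClosure ≤ LinearMap.ker (innerSL ℂ y).toLinearMap :=
    Submodule.topologicalClosure_minimal _ (Submodule.span_le.2 fun a ha => by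
      simpa using inner_eq_zero_symm.1 (h1 a ha)) (innerSL ℂ y).isClosed_ker
  exact inner_eq_zero_symm.1 (this hx)

/-- A normal functional vanishes at `z` as soon as it vanishes at all the matrix corners of `z`. -/
theorem inner_ampliation_eq_zero_of_entries (z : ℓ²(J, H) →L[ℂ] ℓ²(J, H))
    (ξ η : ℓ²(ι, ℓ²(J, H)))
    (h : ∀ k l, inner ℂ (ampliation ι (lpRow k) η)
      (ampliation ι (lpRow k ∘L z ∘L lpCol l) (ampliation ι (lpRow l) ξ)) = 0) :
    inner ℂ η (ampliation ι z ξ) = 0 := by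
  rw [← adjoint_inner_left]
  refine inner_eq_zero_of_mem_closure_span (A := Set.range fun k : J =>
      adjoint (ampliation ι z) (ampliation ι (lpCol k) (ampliation ι (lpRow k) η))) ?_
      (map_mem_of_mem_closure_span (x := adjoint (ampliation ι z))
        (Submodule.isClosed_topologicalClosure _) ?_ η (mem_closure_span_coordinates η))
      (mem_closure_span_coordinates ξ)
  · rintro _ ⟨k, rfl⟩ _ ⟨l, rfl⟩
    dsimp only
    rw [adjoint_inner_left, ← h k l, ampliation_comp_apply, ampliation_comp_apply,
      ← adjoint_lpCol (H := H) k, ← adjoint_ampliation, adjoint_inner_right, adjoint_ampliation,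
      adjoint_lpCol]
  · rintro _ ⟨k, rfl⟩
    exact Submodule.le_topologicalClosure _ (Submodule.subset_span ⟨k, rfl⟩)

/-- Since t is isometric, z = t* (t z t*) t. Each matrix entry is put back as an operator on X, the
form in which it can be matched with an elementary tensor x ⊗ e_kl. -/
theorem inner_ampliation_eq_zero_of_corners {X : Type*} [NormedAddCommGroup X]
    [InnerProductSpace ℂ X] [CompleteSpace X] {t : X →L[ℂ] ℓ²(J, H)}
    (ht : adjoint t ∘L t = ContinuousLinearMap.id ℂ X) (z : X →L[ℂ] X) (ξ η : ℓ²(ι, X))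
    (h : ∀ k l, inner ℂ η (ampliation ι (adjoint t ∘L lpCol k ∘L
      (lpRow k ∘L (t ∘L z ∘L adjoint t) ∘L lpCol l) ∘L lpRow l ∘L t) ξ) = 0) :
    inner ℂ η (ampliation ι z ξ) = 0 := by
  have ht' (f) : adjoint t (t f) = f := congr($ht f)
  have h1 : z = adjoint t ∘L (t ∘L z ∘L adjoint t) ∘L t := by
    ext f; simp [ht']
  rw [h1, inner_ampliation_adjoint_comp, ampliation_comp_apply _ t]
  refine inner_ampliation_eq_zero_of_entries _ _ _ fun k l => ?_
  rw [← h k l, inner_ampliation_adjoint_comp, ← adjoint_lpRow (H := H) k,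
    inner_ampliation_adjoint_comp, ampliation_comp_apply _ (lpRow l ∘L t)]
  rfl

theorem adjoint_entry_starProjection (V : Submodule ℂ ℓ²(ι, H)) [V.HasOrthogonalProjection]
    (i j : ι) : adjoint (lpRow i ∘L V.starProjection ∘L lpCol j) =
      lpRow j ∘L V.starProjection ∘L lpCol i := by
  rw [adjoint_comp, adjoint_comp, adjoint_lpCol, adjoint_lpRow,
    (isSelfAdjoint_starProjection V).adjoint_eq]
  rfl

end Entries

/-! ### Double commutant argument for a ternary ring of operators -/

section Commutant

variable {H K : Type*}
  [NormedAddCommGroup H] [InnerProductSpace ℂ H] [CompleteSpace H]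
  [NormedAddCommGroup K] [InnerProductSpace ℂ K] [CompleteSpace K]

/-- The commutant of the linking algebra of `M ⊆ B(H, K)`, as pairs of operators on `H` and `K`. -/
def linkingCommutant (M : Submodule ℂ (H →L[ℂ] K)) : Set ((H →L[ℂ] H) × (K →L[ℂ] K)) :=
  {p | ∀ m ∈ M, m ∘L p.1 = p.2 ∘L m ∧ m ∘L adjoint p.1 = adjoint p.2 ∘L m}

/-- An operator `K → H` intertwining the linking commutant is a limit of adjoints of elements of
`M`, uniformly on any given square-summable sequence. -/
theorem ampliation_mem_closure_adjoint {ι : Type*} {M : Submodule ℂ (H →L[ℂ] K)} (hM : IsTRO M)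
    (hnd : ∀ k, (∀ m ∈ M, adjoint m k = 0) → k = 0) {w : K →L[ℂ] H}
    (hw : ∀ p ∈ linkingCommutant M, w ∘L p.2 = p.1 ∘L w) (ξ : ℓ²(ι, K)) :
    ampliation ι w ξ ∈ (Submodule.span ℂ
      {f | ∃ m ∈ M, f = ampliation ι (adjoint m) ξ}).topologicalClosure := by
  set W := (Submodule.span ℂ {f | ∃ m ∈ M, f = ampliation ι (adjoint m) ξ}).topologicalClosure
   
  set V := (Submodule.span ℂ ((fun a : ℓ²(ι, K) →L[ℂ] ℓ²(ι, K) => a ξ) ''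
    {a | ∃ m ∈ M, ∃ n ∈ M, a = ampliation ι (m ∘L adjoint n)})).topologicalClosure
  have hWV : ∀ m ∈ M, ∀ f ∈ W, ampliation ι m f ∈ V := fun m hm =>
    map_mem_of_mem_closure_span (Submodule.isClosed_topologicalClosure _) (by
      rintro _ ⟨n, hn, rfl⟩
      exact Submodule.le_topologicalClosure _ (Submodule.subset_span
        ⟨_, ⟨m, hm, n, hn, rfl⟩, ampliation_comp_apply _ _ _⟩))
  -- Here the TRO identity enters: m* n p* = (p n* m)*.
  have hVW : ∀ m ∈ M, ∀ f ∈ V, adjoint (ampliation ι m) f ∈ W := fun m hm =>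
    map_mem_of_mem_closure_span (Submodule.isClosed_topologicalClosure _) (by
      rintro _ ⟨_, ⟨n, hn, p, hp, rfl⟩, rfl⟩
      refine Submodule.le_topologicalClosure _ (Submodule.subset_span
        ⟨_, hM p hp n hn m hm, ?_⟩)
      rw [adjoint_ampliation, adjoint_comp, adjoint_comp, adjoint_adjoint]
      ext; simp)
  -- M M* is a self-adjoint semigroup, nondegenerate because m m* g = 0 implies m* g = 0.
  have hξ : ξ ∈ V := by
    refine mem_closure_span_orbit ?_ ?_ ?_ ξ
    · rintro _ ⟨m, hm, n, hn, rfl⟩ _ ⟨m', hm', n', hn', rfl⟩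
      exact ⟨_, hM m hm n hn m' hm', n', hn', by ext; simp⟩
    · rintro _ ⟨m, hm, n, hn, rfl⟩
      exact ⟨n, hn, m, hm, by rw [adjoint_ampliation, adjoint_comp, adjoint_adjoint]⟩
    · intro g hg
      ext i
      refine hnd _ fun m hm => ?_
      have h : m (adjoint m (g i)) = 0 := congr($(hg _ ⟨m, hm, m, hm, rfl⟩) i)
      rw [← inner_self_eq_zero (𝕜 := ℂ), adjoint_inner_left, h, inner_zero_right]
  -- M exchanges W and V, so it intertwines their projections; matching matrix entries of the two
  -- projections therefore form pairs in the linking commutant, which w intertwines.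
  have hcomm (i j : ι) : (lpRow i ∘L W.starProjection ∘L lpCol j,
      lpRow i ∘L V.starProjection ∘L lpCol j) ∈ linkingCommutant M := by
    have key (i j : ι) {m} (hm : m ∈ M) : m ∘L lpRow i ∘L W.starProjection ∘L lpCol j =
        (lpRow i ∘L V.starProjection ∘L lpCol j) ∘L m := by
      ext f
      have h := congr($(comp_starProjection_eq W V (hWV m hm) (hVW m hm)) (lpCol j f) i)
      simpa [ampliation_lpCol] using h
    intro m hm
    refine ⟨key i j hm, ?_⟩
    simp only [adjoint_entry_starProjection]
    exact key j i hm
  have hPw : ampliation ι w ∘L V.starProjection = W.starProjection ∘L ampliation ι w := by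
    refine ext_entries fun i j => ?_
    ext f
    have h := congr($(hw _ (hcomm i j)) f)
    simpa [ampliation_lpCol] using h
  have h := congr($hPw ξ)
  rw [comp_apply, comp_apply, Submodule.starProjection_eq_self_iff.2 hξ] at h
  rw [h]
  exact Submodule.starProjection_apply_mem _ _

/-- A normal functional annihilating T is tested on u* x v one entry of x at a time. The rows of u
and v intertwine the commutant, so their values on the test sequences are limits of values of M*;
the functional is thereby reduced to elements m s n* of T, where it vanishes. -/
theorem adjoint_comp_comp_mem {J : Type*} {M : Submodule ℂ (H →L[ℂ] K)} (hM : IsTRO M)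
    (hnd : ∀ k, (∀ m ∈ M, adjoint m k = 0) → k = 0)
    {S : Submodule ℂ (H →L[ℂ] H)} {T : Submodule ℂ (K →L[ℂ] K)}
    (hT : @IsClosed _ (sigmaWeakTopology K K) (T : Set (K →L[ℂ] K)))
    (hST : ∀ m ∈ M, ∀ s ∈ S, ∀ n ∈ M, m ∘L s ∘L adjoint n ∈ T)
    {u v : K →L[ℂ] ℓ²(J, H)}
    (hu : ∀ p ∈ linkingCommutant M, u ∘L p.2 = ampliation J p.1 ∘L u)
    (hv : ∀ p ∈ linkingCommutant M, v ∘L p.2 = ampliation J p.1 ∘L v)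
    {x : ℓ²(J, H) →L[ℂ] ℓ²(J, H)} (hx : ∀ k l, lpRow k ∘L x ∘L lpCol l ∈ S) :
    adjoint u ∘L x ∘L v ∈ T := by
  refine mem_of_wStarClosed hT fun ξ η h => ?_
  rw [ampliation_comp_apply, ampliation_comp_apply, ← adjoint_ampliation, adjoint_inner_right]
  refine inner_ampliation_eq_zero_of_entries x _ _ fun k l => ?_
  have hrow {w : K →L[ℂ] ℓ²(J, H)}
      (hw : ∀ p ∈ linkingCommutant M, w ∘L p.2 = ampliation J p.1 ∘L w) (k : J) :
      ∀ p ∈ linkingCommutant M, (lpRow k ∘L w) ∘L p.2 = p.1 ∘L lpRow k ∘L w := fun p hp => by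
    rw [comp_assoc, hw p hp]; rfl
  rw [← ampliation_comp_apply (lpRow k) u, ← ampliation_comp_apply (lpRow l) v,
    ← adjoint_inner_left]
  refine inner_eq_zero_of_mem_closure_span
    (A := {f | ∃ m ∈ M, f = adjoint (ampliation ℕ (lpRow k ∘L x ∘L lpCol l))
      (ampliation ℕ (adjoint m) η)}) ?_
    (map_mem_of_mem_closure_span (x := adjoint (ampliation ℕ (lpRow k ∘L x ∘L lpCol l)))
        (Submodule.isClosed_topologicalClosure _) ?_ _
        (ampliation_mem_closure_adjoint hM hnd (hrow hu k) η))
    (ampliation_mem_closure_adjoint hM hnd (hrow hv l) ξ)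
  · rintro _ ⟨m, hm, rfl⟩ _ ⟨n, hn, rfl⟩
    rw [adjoint_inner_left, ← h _ (hST m hm _ (hx k l) n hn), ← adjoint_ampliation m,
      adjoint_inner_left, ampliation_comp_apply m, ampliation_comp_apply _ (adjoint n)]
  · rintro _ ⟨m, hm, rfl⟩
    exact Submodule.le_topologicalClosure _ (Submodule.subset_span ⟨m, hm, rfl⟩)

end Commutant

/-! ### Schröder–Bernstein for intertwining isometries -/

section SchroederBernstein

variable {X Y : Type*}
  [NormedAddCommGroup X] [InnerProductSpace ℂ X] [CompleteSpace X]
  [NormedAddCommGroup Y] [InnerProductSpace ℂ Y] [CompleteSpace Y]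

theorem adjoint_intertwines {A : X →L[ℂ] Y} {a : X →L[ℂ] X} {b : Y →L[ℂ] Y}
    (h : A ∘L adjoint a = adjoint b ∘L A) : adjoint A ∘L b = a ∘L adjoint A := by
  have h' := congrArg adjoint h
  rw [adjoint_comp, adjoint_comp, adjoint_adjoint, adjoint_adjoint] at h'
  exact h'.symm

/-- **Schröder–Bernstein** for intertwining isometries. -/
theorem exists_unitary_intertwiner {R : Set ((X →L[ℂ] X) × (Y →L[ℂ] Y))}
    (hR : ∀ p ∈ R, (adjoint p.1, adjoint p.2) ∈ R)
    {A : X →L[ℂ] Y} (hA : ∀ p ∈ R, A ∘L p.1 = p.2 ∘L A)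
    (hAA : adjoint A ∘L A = ContinuousLinearMap.id ℂ X)
    {B : Y →L[ℂ] X} (hB : ∀ p ∈ R, B ∘L p.2 = p.1 ∘L B)
    (hBB : adjoint B ∘L B = ContinuousLinearMap.id ℂ Y) :
    ∃ U : X →L[ℂ] Y, (∀ p ∈ R, U ∘L p.1 = p.2 ∘L U) ∧
      adjoint U ∘L U = ContinuousLinearMap.id ℂ X ∧
      U ∘L adjoint U = ContinuousLinearMap.id ℂ Y := by
  have hB' : ∀ p ∈ R, adjoint B ∘L p.1 = p.2 ∘L adjoint B := fun p hp =>
    adjoint_intertwines (hB _ (hR p hp))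
  have hAA' (x : X) : adjoint A (A x) = x := congr($hAA x)
  have hBB' (y : Y) : adjoint B (B y) = y := congr($hBB y)
  let C : X →L[ℂ] X := B ∘L A
  let D : X →L[ℂ] X := ContinuousLinearMap.id ℂ X - B ∘L adjoint B
  have hD : adjoint D = D := by
    simp only [D, map_sub, adjoint_comp, adjoint_adjoint, adjoint_id]
  have hD_apply (x : X) : D x = x - B (adjoint B x) := rfl
  have hDB (y : Y) : D (B y) = 0 := by rw [hD_apply, hBB', sub_self]
  have hBD (x : X) : adjoint B (D x) = 0 := by rw [hD_apply, map_sub, hBB', sub_self]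
  -- As in the set-theoretic proof: D projects onto the complement of the range of B, and G is
  -- generated by the images of that complement under the powers of C = B A. The unitary will be A
  -- on G and B* on G⊥.
  let g : Set X := {z | ∃ (n : ℕ) (x : X), z = (C ^ n) (D x)}
  let G := (Submodule.span ℂ g).topologicalClosure
  have hG : IsClosed (G : Set X) := Submodule.isClosed_topologicalClosure _
  have hgG : ∀ z ∈ g, z ∈ G := fun z hz =>
    Submodule.le_topologicalClosure _ (Submodule.subset_span hz)
  let P := G.starProjection
  have hCG : ∀ z ∈ G, C z ∈ G := map_mem_of_mem_closure_span hG (by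
    rintro _ ⟨n, x, rfl⟩
    exact hgG _ ⟨n + 1, x, by rw [pow_succ']; rfl⟩)
  have hPself : adjoint P = P := (isSelfAdjoint_starProjection G).adjoint_eq
  have hPmem (x : X) : P x ∈ G := G.starProjection_apply_mem x
  have hPof {x : X} (hx : x ∈ G) : P x = x := Submodule.starProjection_eq_self_iff.2 hx
  have hPP (x : X) : P (P x) = P x := hPof (hPmem x)
  have hPD (x : X) : P (D x) = D x := hPof (hgG _ ⟨0, x, by simp⟩)
  have hDP (x : X) : D (P x) = D x := by
    have h : P ∘L D = D := by ext x; exact hPD x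
    have h' := congrArg adjoint h
    rw [adjoint_comp, hPself, hD] at h'
    exact congr($h' x)
  have hCP (x : X) : P (B (A (P x))) = B (A (P x)) := hPof (hCG _ (hPmem x))
  have hPC (x : X) : P (adjoint A (adjoint B (P x))) = P (adjoint A (adjoint B x)) := by
    have h : P ∘L (B ∘L A) ∘L P = (B ∘L A) ∘L P := by ext x; exact hCP x
    have h' := congrArg adjoint h
    simp only [adjoint_comp, hPself] at h'
    exact congr($h' x)
  -- This is G = D X ⊕ B A G at the level of projections; both sides are compared on the generators
  -- of G. Compressed by B it gives B* P B = A P A*, hence surjectivity of U.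
  have hPsplit (x : X) : P x = D x + B (A (P (adjoint A (adjoint B x)))) := by
    have h1 : ∀ z ∈ G, D z + B (A (P (adjoint A (adjoint B z)))) - z = 0 :=
      map_mem_of_mem_closure_span (W := ⊥) (by simp)
        (x := D + B ∘L A ∘L P ∘L adjoint A ∘L adjoint B - ContinuousLinearMap.id ℂ X) (by
        rintro _ ⟨n, x, rfl⟩
        rw [Submodule.mem_bot]
        change D _ + B (A (P (adjoint A (adjoint B _)))) - _ = 0
        cases n with
        | zero => simp [hBD, hD_apply (D x)]
        | succ n =>
          have h : (C ^ (n + 1)) (D x) = B (A ((C ^ n) (D x))) := by rw [pow_succ']; rfl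
          rw [h, hDB, hBB', hAA', hPof (hgG _ ⟨n, x, rfl⟩), zero_add]
          exact sub_self _)
    have h2 := h1 _ (hPmem x)
    rw [hDP, hPC, sub_eq_zero] at h2
    exact h2.symm
  have hRP : ∀ p ∈ R, ∀ z ∈ G, p.1 z ∈ G := fun p hp => map_mem_of_mem_closure_span hG (by
    rintro _ ⟨n, x, rfl⟩
    have hC : p.1 * C = C * p.1 := by
      ext x
      have h1 := congr($(hB p hp) (A x))
      have h2 := congr($(hA p hp) x)
      simp only [comp_apply] at h1 h2
      simp [C, ← h1, h2]
    have hDp : p.1 (D x) = D (p.1 x) := by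
      have h1 := congr($(hB p hp) (adjoint B x))
      have h2 := congr($(hB' p hp) x)
      simp only [comp_apply] at h1 h2
      rw [hD_apply, hD_apply, map_sub, h2, h1]
    have h := congr($((Commute.pow_right (show Commute p.1 C from hC) n).eq) (D x))
    change p.1 ((C ^ n) (D x)) = (C ^ n) (p.1 (D x)) at h
    rw [h, hDp]
    exact hgG _ ⟨n, _, rfl⟩)
  have hPR : ∀ p ∈ R, p.1 ∘L P = P ∘L p.1 := fun p hp =>
    comp_starProjection_eq G G (hRP p hp) (hRP _ (hR p hp))
  let U : X →L[ℂ] Y := A ∘L P + adjoint B - adjoint B ∘L P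
  have hU : adjoint U = P ∘L adjoint A + B - P ∘L B := by
    simp only [U, map_add, map_sub, adjoint_comp, adjoint_adjoint, hPself]
  refine ⟨U, fun p hp => ?_, ?_, ?_⟩
  · ext x
    have h1 := congr($(hPR p hp) x)
    have h2 := congr($(hB' p hp) x)
    have h3 := congr($(hB' p hp) (P x))
    have h4 := congr($(hA p hp) (P x))
    simp only [comp_apply] at h1 h2 h3 h4
    simp [U, ← h1, h2, h3, h4]
  · rw [hU]
    ext x
    have h1 := hCP x
    have h3 := hPD x
    have h4 := hPC x
    rw [hD_apply, map_sub] at h3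
    -- P D = D, used at x and at P x, gives (1 - P) B B* (1 - P) = 1 - P.
    have h5 := hPD (P x)
    rw [hD_apply, map_sub, hPP] at h5
    simp only [U, add_apply, sub_apply, comp_apply, map_add, map_sub, hAA', hPP, id_apply, h1, h4]
    linear_combination (norm := module) h3 - h5
  · rw [hU]
    ext y
    have h1 := hPsplit (B y)
    rw [hDB, hBB', zero_add] at h1
    simp only [U, add_apply, sub_apply, comp_apply, map_add, map_sub, hBB', hPP, hCP, id_apply, h1]
    abel

end SchroederBernstein

/-! ### Columns of operators and isometries of ampliations -/

section Columns

variable {ι J H K : Type*}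
  [NormedAddCommGroup H] [InnerProductSpace ℂ H]
  [NormedAddCommGroup K] [InnerProductSpace ℂ K]

theorem exists_column (v : ι → H →L[ℂ] K)
    (hv : ∀ h, ∀ s : Finset ι, ∑ i ∈ s, ‖v i h‖ ^ 2 ≤ ‖h‖ ^ 2) :
    ∃ V : H →L[ℂ] ℓ²(ι, K), (∀ h i, V h i = v i h) ∧ ∀ h, ‖V h‖ ≤ ‖h‖ := by
  have hs (h : H) : Summable fun i => ‖v i h‖ ^ 2 :=
    summable_of_sum_le (fun _ => by positivity) (hv h)
  let V : H →ₗ[ℂ] ℓ²(ι, K) :=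
    { toFun := fun h => ⟨fun i => v i h, memℓp_two_of_summable (hs h)⟩
      map_add' := fun f g => Subtype.ext (funext fun i => (v i).map_add f g)
      map_smul' := fun c f => Subtype.ext (funext fun i => (v i).map_smul c f) }
  have hV (h : H) : ‖V h‖ ≤ ‖h‖ := by
    refine le_of_sq_le_sq ?_ (by positivity)
    exact hasSum_le_of_sum_le (lp_hasSum_norm_sq (V h)) (hv h)
  exact ⟨V.mkContinuous 1 fun h => by simpa using hV h, fun _ _ => rfl, hV⟩

/-- A column of operators with `∑ vᵢ* vᵢ = 1`, repeated along an injection `J × ι → J`, is an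
isometry of infinite ampliations. -/
theorem exists_isometry_of_column [CompleteSpace H] [CompleteSpace K]
    {v : ι → H →L[ℂ] K} (hv : ∀ h, HasSum (fun i => ‖v i h‖ ^ 2) (‖h‖ ^ 2))
    {e : J × ι → J} (he : e.Injective) :
    ∃ A : ℓ²(J, H) →L[ℂ] ℓ²(J, K),
      (∀ (a : H →L[ℂ] H) (b : K →L[ℂ] K), (∀ i, v i ∘L a = b ∘L v i) →
        A ∘L ampliation J a = ampliation J b ∘L A) ∧
      adjoint A ∘L A = ContinuousLinearMap.id ℂ _ := by
  -- The vector vᵢ f_j is placed in slot e (j, i); slots outside the range of e are filled with 0,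
  -- so no norm is added.
  let T (f : J → H) : J → K := Function.extend e (fun p => v p.2 (f p.1)) 0
  have hT (f : J → H) (p : J × ι) : T f (e p) = v p.2 (f p.1) := he.extend_apply _ _ _
  have hT' (f : J → H) (j : J) (hj : ¬ ∃ p, e p = j) : T f j = 0 :=
    Function.extend_apply' _ _ _ hj
  have hsum (f : ℓ²(J, H)) : HasSum (fun j => ‖T f j‖ ^ 2) (‖f‖ ^ 2) := by
    have h0 : ∀ j ∉ Set.range e, ‖T f j‖ ^ 2 = 0 := fun j hj => by
      rw [hT' _ _ hj]; simp
    rw [← he.hasSum_iff h0]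
    have h1 : (fun j => ‖T f j‖ ^ 2) ∘ e = fun p : J × ι => ‖v p.2 (f p.1)‖ ^ 2 :=
      funext fun p => by simp only [Function.comp_apply, hT]
    rw [h1]
    have h2 : Summable fun p : J × ι => ‖v p.2 (f p.1)‖ ^ 2 := by
      rw [summable_prod_of_nonneg fun _ => by positivity]
      refine ⟨fun j => (hv (f j)).summable, ?_⟩
      simp only [(hv _).tsum_eq]
      exact (lp_hasSum_norm_sq f).summable
    have h3 := h2.hasSum.prod_fiberwise fun j => hv (f j)
    rw [← h3.unique (lp_hasSum_norm_sq f)]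
    exact h2.hasSum
  let A : ℓ²(J, H) →ₗᵢ[ℂ] ℓ²(J, K) :=
    { toFun := fun f => ⟨T f, memℓp_two_of_summable (hsum f).summable⟩
      map_add' := fun f g => Subtype.ext (funext fun j => by
        change T (f + g) j = T f j + T g j
        by_cases hj : ∃ p, e p = j
        · obtain ⟨p, rfl⟩ := hj
          simp only [hT]
          exact map_add _ _ _
        · simp only [hT' _ _ hj, add_zero])
      map_smul' := fun c f => Subtype.ext (funext fun j => by
        change T (c • f) j = c • T f j
        by_cases hj : ∃ p, e p = j
        · obtain ⟨p, rfl⟩ := hj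
          simp only [hT]
          exact map_smul _ _ _
        · simp only [hT' _ _ hj, smul_zero])
      norm_map' := fun f => by
        rw [← sq_eq_sq₀ (norm_nonneg _) (norm_nonneg _)]
        exact (lp_hasSum_norm_sq _).unique (hsum f) }
  refine ⟨A.toContinuousLinearMap, fun a b hab => ?_, ?_⟩
  · ext f j
    change T (fun i => a (f i)) j = b (T f j)
    by_cases hj : ∃ p, e p = j
    · obtain ⟨p, rfl⟩ := hj
      simp only [hT]
      exact congr($(hab p.2) (f p.1))
    · simp only [hT' _ _ hj, map_zero]
  · exact (ContinuousLinearMap.norm_map_iff_adjoint_comp_self _).1 A.norm_map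

end Columns

/-! ### Exhaustion by intertwiners -/

section Exhaustion

variable {H K : Type*}
  [NormedAddCommGroup H] [InnerProductSpace ℂ H] [CompleteSpace H]
  [NormedAddCommGroup K] [InnerProductSpace ℂ K] [CompleteSpace K]

/-- The left side expands to ‖h‖² - 2‖V h‖² + ‖V* V h‖², and V* is a contraction. This leaves room
for one more entry in the column of `exists_intertwining_column`. -/
theorem norm_sq_sub_adjoint_comp_self_le {V : H →L[ℂ] K} (hV : ∀ h, ‖V h‖ ≤ ‖h‖) (h : H) :
    ‖h - adjoint V (V h)‖ ^ 2 ≤ ‖h‖ ^ 2 - ‖V h‖ ^ 2 := by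
  have h1 : ‖adjoint V (V h)‖ ≤ ‖V h‖ := by
    have : ‖V‖ ≤ 1 := V.opNorm_le_bound zero_le_one fun h => by simpa using hV h
    calc _ ≤ ‖adjoint V‖ * ‖V h‖ := le_opNorm _ _
      _ ≤ 1 * ‖V h‖ := by gcongr; rwa [LinearIsometryEquiv.norm_map]
      _ = _ := one_mul _
  have h2 : RCLike.re (inner ℂ h (adjoint V (V h))) = ‖V h‖ ^ 2 := by
    rw [adjoint_inner_right, inner_self_eq_norm_sq]
  rw [norm_sub_sq (𝕜 := ℂ), h2]
  nlinarith [norm_nonneg (adjoint V (V h))]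

/-- If intertwiners separate the points of `H`, there is a family of intertwiners `vᵢ : H → K` with
`∑ vᵢ* vᵢ = 1`. -/
theorem exists_intertwining_column {R : Set ((H →L[ℂ] H) × (K →L[ℂ] K))}
    (hR : ∀ p ∈ R, (adjoint p.1, adjoint p.2) ∈ R)
    (hsep : ∀ h ≠ 0, ∃ m : H →L[ℂ] K, (∀ p ∈ R, m ∘L p.1 = p.2 ∘L m) ∧ m h ≠ 0) :
    ∃ F : Set (ℕ × (H →L[ℂ] K)), (∀ q ∈ F, ∀ p ∈ R, q.2 ∘L p.1 = p.2 ∘L q.2) ∧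
      ∀ h, HasSum (fun q : F => ‖q.1.2 h‖ ^ 2) (‖h‖ ^ 2) := by
  classical
  -- The label in ℕ lets the same operator occur infinitely often in a family.
  let 𝒞 : Set (Set (ℕ × (H →L[ℂ] K))) := {F | (∀ q ∈ F, ∀ p ∈ R, q.2 ∘L p.1 = p.2 ∘L q.2) ∧
    ∀ s : Finset (ℕ × (H →L[ℂ] K)), ↑s ⊆ F → ∀ h, ∑ q ∈ s, ‖q.2 h‖ ^ 2 ≤ ‖h‖ ^ 2}
  obtain ⟨F, hF⟩ : ∃ F, Maximal (· ∈ 𝒞) F := by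
    refine zorn_subset 𝒞 fun c hc hchain => ?_
    rcases c.eq_empty_or_nonempty with rfl | hne
    · refine ⟨∅, ⟨by simp, fun s hs h => ?_⟩, by simp⟩
      rw [Set.subset_empty_iff, Finset.coe_eq_empty] at hs
      simp [hs]
    · refine ⟨⋃₀ c, ⟨?_, fun s hs h => ?_⟩, fun _ => Set.subset_sUnion_of_mem⟩
      · rintro q ⟨F, hF, hq⟩
        exact (hc hF).1 q hq
      · obtain ⟨F, hF, hsF⟩ := hchain.directedOn.exists_mem_subset_of_finset_subset_biUnion
          (f := id) hne (by rwa [Set.sUnion_eq_biUnion] at hs)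
        exact (hc hF).2 s hsF h
  have hFC := hF.prop
  have hfin (h : H) (s : Finset F) : ∑ q ∈ s, ‖q.1.2 h‖ ^ 2 ≤ ‖h‖ ^ 2 := by
    have := hFC.2 (s.map (Function.Embedding.subtype _)) (by
      intro q; simp only [Finset.coe_map, Set.mem_image]; rintro ⟨q, -, rfl⟩; exact q.2) h
    rwa [Finset.sum_map] at this
  obtain ⟨V, hV, hVle⟩ := exists_column (fun q : F => q.1.2) hfin
  have hVR : ∀ p ∈ R, V ∘L p.1 = ampliation F p.2 ∘L V := fun p hp => by
    ext h q
    have := congr($(hFC.1 q.1 q.2 p hp) h)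
    simpa [hV] using this
  have hd : ∀ h, h - adjoint V (V h) = 0 := by
    by_contra! hne
    obtain ⟨h₀, hh₀⟩ := hne
    obtain ⟨m, hm, hmh⟩ := hsep _ hh₀
    let d : H →L[ℂ] H := ContinuousLinearMap.id ℂ H - adjoint V ∘L V
    have hdR : ∀ p ∈ R, d ∘L p.1 = p.1 ∘L d := fun p hp => by
      have h1 := hVR p hp
      have h2 : adjoint V ∘L ampliation F p.2 = p.1 ∘L adjoint V := adjoint_intertwines (by
        rw [adjoint_ampliation]; exact hVR _ (hR p hp))
      ext h
      have h1 := congr($h1 h)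
      have h2 := congr($h2 (V h))
      simp only [comp_apply] at h1 h2
      simp [d, h1, h2]
    -- The defect d = 1 - V* V commutes with R, so m d is an intertwiner; dividing by ‖m‖ keeps its
    -- contribution within the defect ‖h‖² - ‖V h‖².
    let n : H →L[ℂ] K := ((‖m‖⁻¹ : ℝ) : ℂ) • m ∘L d
    have hnR : ∀ p ∈ R, n ∘L p.1 = p.2 ∘L n := fun p hp => by
      have h1 := hm p hp
      have h2 := hdR p hp
      ext h
      have h2 := congr($h2 h)
      have h1 := congr($h1 (d h))
      simp only [comp_apply] at h1 h2
      simp only [n, comp_apply, smul_apply, h2, h1, map_smul]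
    have hnle (h : H) : ‖n h‖ ^ 2 ≤ ‖h‖ ^ 2 - ‖V h‖ ^ 2 := by
      refine le_trans ?_ (norm_sq_sub_adjoint_comp_self_le hVle h)
      gcongr
      change ‖((‖m‖⁻¹ : ℝ) : ℂ) • m (d h)‖ ≤ ‖d h‖
      rw [norm_smul, Complex.norm_real, norm_inv, norm_norm]
      exact inv_mul_le_of_le_mul₀ (norm_nonneg _) (norm_nonneg _) (m.le_opNorm _)
    have hn0 : 0 < ‖n h₀‖ ^ 2 := by
      have : m ≠ 0 := fun h => hmh (by rw [h]; rfl)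
      have h3 : n h₀ ≠ 0 := smul_ne_zero (by simpa using this) hmh
      positivity
    -- By maximality every copy (k, n) already lies in F, so N‖n h₀‖² ≤ ‖h₀‖² for all N, which is
    -- absurd.
    have hmem (k : ℕ) : (k, n) ∈ F := by
      refine hF.mem_of_prop_insert ⟨?_, fun s hs h => ?_⟩
      · rintro q (rfl | hq)
        · exact hnR
        · exact hFC.1 q hq
      · have h1 : ∑ q ∈ s.erase (k, n), ‖q.2 h‖ ^ 2 ≤ ‖V h‖ ^ 2 := by
          have hsub : ∀ q ∈ s.erase (k, n), q ∈ F := fun q hq =>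
            (hs (Finset.mem_of_mem_erase hq)).resolve_left (Finset.ne_of_mem_erase hq)
          have := sum_le_hasSum ((s.erase (k, n)).subtype (· ∈ F)) (fun _ _ => by positivity)
            (lp_hasSum_norm_sq (V h))
          simp only [hV] at this
          rwa [Finset.sum_subtype_of_mem (fun q : ℕ × (H →L[ℂ] K) => ‖q.2 h‖ ^ 2) hsub] at this
        have h2 : ∑ q ∈ s, ‖q.2 h‖ ^ 2 ≤ ∑ q ∈ s.erase (k, n), ‖q.2 h‖ ^ 2 + ‖n h‖ ^ 2 := by
          by_cases hk : (k, n) ∈ s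
          · exact (Finset.sum_erase_add s _ hk).ge
          · rw [Finset.erase_eq_of_notMem hk]
            exact le_add_of_nonneg_right (by positivity)
        linarith [hnle h]
    obtain ⟨N, hN⟩ := exists_nat_gt (‖h₀‖ ^ 2 / ‖n h₀‖ ^ 2)
    have h4 := hFC.2 ((Finset.range N).image fun k => (k, n)) (by
      intro q; simp only [Finset.coe_image, Set.mem_image]; rintro ⟨k, -, rfl⟩; exact hmem k) h₀
    rw [Finset.sum_image (by simp [Set.InjOn])] at h4
    simp only [Finset.sum_const, Finset.card_range, nsmul_eq_mul] at h4
    rw [div_lt_iff₀ hn0] at hN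
    linarith
  refine ⟨F, hFC.1, fun h => ?_⟩
  have h1 := lp_hasSum_norm_sq (V h)
  simp only [hV] at h1
  have h2 : ‖V h‖ ^ 2 = ‖h‖ ^ 2 := by
    rw [← inner_self_eq_norm_sq (𝕜 := ℂ), ← adjoint_inner_right, ← sub_eq_zero.1 (hd h),
      inner_self_eq_norm_sq]
  rwa [h2] at h1

end Exhaustion

/-! ### The tensor product with ℓ²(J) as matrices over J -/

section HilbertTensor

variable {J H : Type*} [NormedAddCommGroup H] [InnerProductSpace ℂ H] [CompleteSpace H]

/-- The map h ⊗ f ↦ (f_j h)_j preserves inner products, and its range contains all finitely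
supported families; it therefore extends to the completion as a unitary. -/
theorem exists_hilbertTensor_equiv (J H : Type*) [NormedAddCommGroup H] [InnerProductSpace ℂ H]
    [CompleteSpace H] :
    ∃ Θ : HilbertTensor H ℓ²(J, ℂ) ≃ₗᵢ[ℂ] ℓ²(J, H), ∀ (h : H) (f : ℓ²(J, ℂ)) (j : J),
      Θ ((h ⊗ₜ[ℂ] f : H ⊗[ℂ] ℓ²(J, ℂ)) : HilbertTensor H ℓ²(J, ℂ)) j = f j • h := by
  let θ : H ⊗[ℂ] ℓ²(J, ℂ) →ₗ[ℂ] ℓ²(J, H) := TensorProduct.lift <|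
    LinearMap.mk₂ ℂ (fun h f => ampliation J (toSpanSingleton ℂ h) f)
      (fun h h' f => by ext; simp) (fun c h f => by ext j; exact smul_comm (f j) c h)
      (fun h f f' => map_add _ _ _) (fun c h f => map_smul _ _ _)
  have hθ (h : H) (f : ℓ²(J, ℂ)) (j : J) : θ (h ⊗ₜ f) j = f j • h := by
    simp [θ]
  have hinner (x y : H ⊗[ℂ] ℓ²(J, ℂ)) : inner ℂ (θ x) (θ y) = inner ℂ x y := by
    induction x with
    | zero => simp
    | add x x' hx hx' => rw [map_add, inner_add_left, inner_add_left, hx, hx']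
    | tmul h f =>
      induction y with
      | zero => simp
      | add y y' hy hy' => rw [map_add, inner_add_right, inner_add_right, hy, hy']
      | tmul h' f' =>
        rw [TensorProduct.inner_tmul, lp.inner_eq_tsum, lp.inner_eq_tsum, ← tsum_mul_left]
        congr 1 with j
        rw [hθ, hθ, inner_smul_left, inner_smul_right]
        simp only [RCLike.inner_apply]
        ring
  have hdense : DenseRange θ := by
    intro f
    refine mem_closure_of_tendsto (hasSum_lpCol f) (Eventually.of_forall fun s => ?_)
    refine LinearMap.mem_range.1 ((LinearMap.range θ).sum_mem fun j _ => ⟨f j ⊗ₜ lpCol j 1, ?_⟩)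
    ext k
    rw [hθ]
    by_cases hk : k = j
    · subst hk; simp
    · simp [lpCol_apply_ne hk]
  refine ⟨(LinearEquiv.refl ℂ (H ⊗[ℂ] ℓ²(J, ℂ))).extendOfIsometry
    (UniformSpace.Completion.toComplL (𝕜 := ℂ)).toLinearMap θ
    (UniformSpace.Completion.denseRange_coe) hdense fun x => ?_, fun h f j => ?_⟩
  · have : ‖θ x‖ = ‖x‖ := by
      rw [norm_eq_sqrt_re_inner (𝕜 := ℂ), hinner]
      exact (norm_eq_sqrt_re_inner (𝕜 := ℂ) x).symm
    exact this.trans (UniformSpace.Completion.norm_coe x).symm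
  · rw [← hθ]
    exact congrArg (fun g : ℓ²(J, H) => g j) (LinearEquiv.extendOfIsometry_eq _ _ _ _ _ _ _)

variable {t : HilbertTensor H ℓ²(J, ℂ) →L[ℂ] ℓ²(J, H)}

omit [CompleteSpace H] in
theorem ext_hilbertTensor {L X : Type*} [NormedAddCommGroup L] [InnerProductSpace ℂ L]
    [NormedAddCommGroup X] [NormedSpace ℂ X] {x y : HilbertTensor H L →L[ℂ] X}
    (h : ∀ (ξ : H) (η : L), x ((ξ ⊗ₜ[ℂ] η : H ⊗[ℂ] L) : HilbertTensor H L) =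
      y ((ξ ⊗ₜ[ℂ] η : H ⊗[ℂ] L) : HilbertTensor H L)) : x = y := by
  ext z
  induction z using UniformSpace.Completion.induction_on with
  | hp => exact isClosed_eq x.continuous y.continuous
  | ih z =>
    induction z with
    | zero => rw [UniformSpace.Completion.coe_zero, map_zero, map_zero]
    | add z z' hz hz' => rw [UniformSpace.Completion.coe_add, map_add, map_add, hz, hz']
    | tmul ξ η => exact h ξ η

/-- The corner of `x ⊗ y`. -/
theorem entry_opTensor (hstar : adjoint t ∘L t = ContinuousLinearMap.id ℂ _)
    (ht : ∀ (h : H) (f : ℓ²(J, ℂ)) (j : J),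
      t ((h ⊗ₜ[ℂ] f : H ⊗[ℂ] ℓ²(J, ℂ)) : HilbertTensor H ℓ²(J, ℂ)) j = f j • h)
    (x : H →L[ℂ] H) (y : ℓ²(J, ℂ) →L[ℂ] ℓ²(J, ℂ)) (i j : J) :
    lpRow i ∘L (t ∘L opTensor x y ∘L adjoint t) ∘L lpCol j = (y (lpCol j 1) i) • x := by
  ext h
  have h1 : t ((h ⊗ₜ[ℂ] lpCol j 1 : H ⊗[ℂ] ℓ²(J, ℂ)) : HilbertTensor H ℓ²(J, ℂ)) =
      lpCol j h := by
    ext k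
    rw [ht]
    by_cases hk : k = j
    · subst hk; simp
    · simp [lpCol_apply_ne hk]
  have h2 : adjoint t (lpCol j h) =
      ((h ⊗ₜ[ℂ] lpCol j 1 : H ⊗[ℂ] ℓ²(J, ℂ)) : HilbertTensor H ℓ²(J, ℂ)) := by
    rw [← h1]
    exact congr($hstar _)
  simp only [comp_apply, h2, opTensor_tmul, lpRow_apply, ht, smul_apply]

omit [CompleteSpace H] in
theorem comp_opTensor_matrixUnit
    (ht : ∀ (h : H) (f : ℓ²(J, ℂ)) (j : J),
      t ((h ⊗ₜ[ℂ] f : H ⊗[ℂ] ℓ²(J, ℂ)) : HilbertTensor H ℓ²(J, ℂ)) j = f j • h)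
    (x : H →L[ℂ] H) (k l : J) :
    t ∘L opTensor x (lpCol k ∘L lpRow l) = lpCol k ∘L x ∘L lpRow l ∘L t := by
  refine ext_hilbertTensor fun h f => ?_
  ext j
  simp only [comp_apply, opTensor_tmul, lpRow_apply, ht]
  by_cases hj : j = k
  · subst hj; simp
  · simp [lpCol_apply_ne hj]

/-- For w*-closed `S`, the space `S ⊗̄ M_J` consists of the operators with entries in `S`. -/
theorem mem_normalSpatialTensor_matrixSpace_iff
    (hstar : adjoint t ∘L t = ContinuousLinearMap.id ℂ _)
    (ht : ∀ (h : H) (f : ℓ²(J, ℂ)) (j : J),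
      t ((h ⊗ₜ[ℂ] f : H ⊗[ℂ] ℓ²(J, ℂ)) : HilbertTensor H ℓ²(J, ℂ)) j = f j • h)
    {S : Submodule ℂ (H →L[ℂ] H)}
    (hS : @IsClosed _ (sigmaWeakTopology H H) (S : Set (H →L[ℂ] H)))
    {z : HilbertTensor H ℓ²(J, ℂ) →L[ℂ] HilbertTensor H ℓ²(J, ℂ)} :
    z ∈ normalSpatialTensor S (matrixSpace J) ↔
      ∀ i j, lpRow i ∘L (t ∘L z ∘L adjoint t) ∘L lpCol j ∈ S := by
  constructor
  · intro hz i j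
    refine mem_of_wStarClosed hS fun ξ η h => ?_
    have key (z : HilbertTensor H ℓ²(J, ℂ) →L[ℂ] HilbertTensor H ℓ²(J, ℂ)) :
        inner ℂ η (ampliation ℕ (lpRow i ∘L (t ∘L z ∘L adjoint t) ∘L lpCol j) ξ) =
          inner ℂ (ampliation ℕ (adjoint t ∘L lpCol i) η)
            (ampliation ℕ z (ampliation ℕ (adjoint t ∘L lpCol j) ξ)) := by
      rw [← inner_ampliation_adjoint_comp, ← ampliation_comp_apply, ← adjoint_lpRow (H := H) i,
        adjoint_comp, adjoint_adjoint, adjoint_adjoint]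
      rfl
    rw [key]
    refine mem_wStarSpan_iff.1 hz _ _ ?_
    rintro _ ⟨x, hx, y, -, rfl⟩
    rw [← key, entry_opTensor hstar ht]
    exact h _ (S.smul_mem _ hx)
  · intro hz
    refine mem_wStarSpan_iff.2 fun ξ η h => ?_
    -- Each entry x of z, put back in its place, is the elementary tensor of x with a matrix unit,
    -- on which the functional vanishes.
    refine inner_ampliation_eq_zero_of_corners hstar z ξ η fun k l => ?_
    have hkl := hz k l
    generalize lpRow k ∘L (t ∘L z ∘L adjoint t) ∘L lpCol l = x at hkl
    have hx : opTensor x (lpCol k ∘L lpRow l) = adjoint t ∘L lpCol k ∘L x ∘L lpRow l ∘L t := by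
      rw [← comp_opTensor_matrixUnit ht, ← comp_assoc, hstar, id_comp]
    rw [← hx]
    exact h _ ⟨x, hkl, _, Submodule.mem_top, rfl⟩

end HilbertTensor

/-! ### Assembling the unitary and the two inclusions -/

section Main

variable {H K : Type*}
  [NormedAddCommGroup H] [InnerProductSpace ℂ H] [CompleteSpace H]
  [NormedAddCommGroup K] [InnerProductSpace ℂ K] [CompleteSpace K]

/-- The space of adjoints of the elements of `M`. -/
def adjointSubmodule (M : Submodule ℂ (H →L[ℂ] K)) : Submodule ℂ (K →L[ℂ] H) where
  carrier := {x | adjoint x ∈ M}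
  add_mem' {x y} hx hy := by
    change adjoint (x + y) ∈ M
    rw [map_add]
    exact M.add_mem hx hy
  zero_mem' := by
    change adjoint 0 ∈ M
    rw [map_zero]
    exact M.zero_mem
  smul_mem' c x hx := by
    change adjoint (c • x) ∈ M
    rw [LinearIsometryEquiv.map_smulₛₗ]
    exact M.smul_mem _ hx

theorem mem_adjointSubmodule {M : Submodule ℂ (H →L[ℂ] K)} {x : K →L[ℂ] H} :
    x ∈ adjointSubmodule M ↔ adjoint x ∈ M := Iff.rfl

theorem IsTRO.adjointSubmodule {M : Submodule ℂ (H →L[ℂ] K)} (hM : IsTRO M) :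
    IsTRO (adjointSubmodule M) := fun a ha b hb c hc => by
  rw [mem_adjointSubmodule, adjoint_comp, adjoint_comp, comp_assoc]
  exact hM _ hc _ hb _ ha

theorem adjoint_mem_linkingCommutant {M : Submodule ℂ (H →L[ℂ] K)} :
    ∀ p ∈ linkingCommutant M, (adjoint p.1, adjoint p.2) ∈ linkingCommutant M :=
  fun p hp m hm => ⟨(hp m hm).2, by simpa only [adjoint_adjoint] using (hp m hm).1⟩

theorem swap_mem_linkingCommutant_adjointSubmodule {M : Submodule ℂ (H →L[ℂ] K)}
    {p : (H →L[ℂ] H) × (K →L[ℂ] K)} (hp : p ∈ linkingCommutant M) :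
    p.swap ∈ linkingCommutant (adjointSubmodule M) := fun m hm => by
  have h := hp _ hm
  constructor
  · have := congrArg adjoint h.2
    simpa only [adjoint_comp, adjoint_adjoint, Prod.fst_swap, Prod.snd_swap] using this.symm
  · have := congrArg adjoint h.1
    simpa only [adjoint_comp, adjoint_adjoint, Prod.fst_swap, Prod.snd_swap] using this.symm

theorem swap_mem_linkingCommutant {M : Submodule ℂ (H →L[ℂ] K)}
    {p : (K →L[ℂ] K) × (H →L[ℂ] H)} (hp : p ∈ linkingCommutant (adjointSubmodule M)) :
    p.swap ∈ linkingCommutant M := fun m hm => by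
  have h := hp (adjoint m) (by rwa [mem_adjointSubmodule, adjoint_adjoint])
  constructor
  · have := congrArg adjoint h.2
    simpa only [adjoint_comp, adjoint_adjoint, Prod.fst_swap, Prod.snd_swap] using this.symm
  · have := congrArg adjoint h.1
    simpa only [adjoint_comp, adjoint_adjoint, Prod.fst_swap, Prod.snd_swap] using this.symm

/-- If M* kills k, the vector functional of k vanishes on every m s n*, hence on the identity, so
⟪k, k⟫ = 0. The sequence with k in slot 0 presents this functional in normal form. -/
theorem eq_zero_of_forall_adjoint_apply_eq_zero {M : Submodule ℂ (H →L[ℂ] K)}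
    {S : Set (H →L[ℂ] H)}
    (h1 : ContinuousLinearMap.id ℂ K ∈ wStarSpan {x : K →L[ℂ] K | ∃ m ∈ M, ∃ s ∈ S, ∃ n ∈ M,
      x = m ∘L s ∘L adjoint n}) (k : K) (hk : ∀ m ∈ M, adjoint m k = 0) : k = 0 := by
  have h := mem_wStarSpan_iff.1 h1 (lpCol 0 k) (lpCol 0 k) (by
    rintro _ ⟨m, -, s, -, n, hn, rfl⟩
    rw [ampliation_lpCol, inner_lpCol_left]
    simp [hk n hn])
  rw [ampliation_lpCol, inner_lpCol_left, lpCol_apply_self] at h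
  exact inner_self_eq_zero.1 h

theorem exists_isometric_intertwiner {J : Type*} {R : Set ((H →L[ℂ] H) × (K →L[ℂ] K))}
    (hR : ∀ p ∈ R, (adjoint p.1, adjoint p.2) ∈ R)
    (hsep : ∀ h ≠ 0, ∃ m : H →L[ℂ] K, (∀ p ∈ R, m ∘L p.1 = p.2 ∘L m) ∧ m h ≠ 0)
    {e : J × (ℕ × (H →L[ℂ] K)) → J} (he : e.Injective) :
    ∃ A : ℓ²(J, H) →L[ℂ] ℓ²(J, K),
      (∀ p ∈ R, A ∘L ampliation J p.1 = ampliation J p.2 ∘L A) ∧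
      adjoint A ∘L A = ContinuousLinearMap.id ℂ _ := by
  obtain ⟨F, hF, hsum⟩ := exists_intertwining_column hR hsep
  obtain ⟨A, hA, hAA⟩ := exists_isometry_of_column hsum
    (e := fun p : J × F => e (p.1, p.2.1)) (fun p q hpq => by
      have := he hpq
      simp only [Prod.mk.injEq] at this
      exact Prod.ext this.1 (Subtype.ext this.2))
  exact ⟨A, fun p hp => hA _ _ fun q => hF q.1 q.2 p hp, hAA⟩

/-- Conjugation by a unitary that intertwines the linking commutant maps `S ⊗̄ M_J` to
`T ⊗̄ M_J`. -/
theorem conj_mem_normalSpatialTensor {J : Type*} {M : Submodule ℂ (H →L[ℂ] K)} (hM : IsTRO M)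
    (hnd : ∀ k, (∀ m ∈ M, adjoint m k = 0) → k = 0)
    {S : Submodule ℂ (H →L[ℂ] H)} {T : Submodule ℂ (K →L[ℂ] K)}
    (hS : @IsClosed _ (sigmaWeakTopology H H) (S : Set (H →L[ℂ] H)))
    (hT : @IsClosed _ (sigmaWeakTopology K K) (T : Set (K →L[ℂ] K)))
    (hST : ∀ m ∈ M, ∀ s ∈ S, ∀ n ∈ M, m ∘L s ∘L adjoint n ∈ T)
    {tH : HilbertTensor H ℓ²(J, ℂ) →L[ℂ] ℓ²(J, H)}
    (hstarH : adjoint tH ∘L tH = ContinuousLinearMap.id ℂ _)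
    (htH : ∀ (h : H) (f : ℓ²(J, ℂ)) (j : J),
      tH ((h ⊗ₜ[ℂ] f : H ⊗[ℂ] ℓ²(J, ℂ)) : HilbertTensor H ℓ²(J, ℂ)) j = f j • h)
    {tK : HilbertTensor K ℓ²(J, ℂ) →L[ℂ] ℓ²(J, K)}
    (hstarK : adjoint tK ∘L tK = ContinuousLinearMap.id ℂ _)
    (hstarK' : tK ∘L adjoint tK = ContinuousLinearMap.id ℂ _)
    (htK : ∀ (h : K) (f : ℓ²(J, ℂ)) (j : J),
      tK ((h ⊗ₜ[ℂ] f : K ⊗[ℂ] ℓ²(J, ℂ)) : HilbertTensor K ℓ²(J, ℂ)) j = f j • h)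
    {U : ℓ²(J, H) →L[ℂ] ℓ²(J, K)}
    (hU : ∀ p ∈ linkingCommutant M, adjoint U ∘L ampliation J p.2 = ampliation J p.1 ∘L adjoint U)
    {z : HilbertTensor H ℓ²(J, ℂ) →L[ℂ] HilbertTensor H ℓ²(J, ℂ)}
    (hz : z ∈ normalSpatialTensor S (matrixSpace J)) :
    (adjoint tK ∘L U ∘L tH) ∘L z ∘L adjoint (adjoint tK ∘L U ∘L tH) ∈
      normalSpatialTensor T (matrixSpace J) := by
  rw [mem_normalSpatialTensor_matrixSpace_iff hstarH htH hS] at hz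
  rw [mem_normalSpatialTensor_matrixSpace_iff hstarK htK hT]
  intro i j
  have hu (i : J) : ∀ p ∈ linkingCommutant M,
      (adjoint U ∘L lpCol i) ∘L p.2 = ampliation J p.1 ∘L adjoint U ∘L lpCol i := fun p hp => by
    ext1 k
    have := congr($(hU p hp) (lpCol i k))
    simpa only [comp_apply, ampliation_lpCol] using this
  have h := adjoint_comp_comp_mem hM hnd hT hST (hu i) (hu j) hz
  convert h using 1
  rw [adjoint_comp, adjoint_comp, adjoint_comp, adjoint_adjoint, adjoint_adjoint, adjoint_lpCol]
  have h' (f) : tK (adjoint tK f) = f := congr($hstarK' f)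
  ext k
  simp only [comp_apply, h']

end Main

end

theorem mainTheorem4 {H : Type u} {K : Type v}
    [NormedAddCommGroup H] [InnerProductSpace ℂ H] [CompleteSpace H]
    [NormedAddCommGroup K] [InnerProductSpace ℂ K] [CompleteSpace K]
    (S : Submodule ℂ (H →L[ℂ] H)) (T : Submodule ℂ (K →L[ℂ] K))
    (hS : IsWStarClosedOperatorSystem S) (hT : IsWStarClosedOperatorSystem T)
    (hST : TROEquivalent S T) :
    ∃ (J : Type (max u v)) (_ : Nonempty J)
      (U : HilbertTensor H ℓ²(J, ℂ) ≃ₗᵢ[ℂ] HilbertTensor K ℓ²(J, ℂ)),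
      normalSpatialTensor T (matrixSpace J) =
        (fun x : HilbertTensor H ℓ²(J, ℂ) →L[ℂ] HilbertTensor H ℓ²(J, ℂ) =>
          (U : HilbertTensor H ℓ²(J, ℂ) →L[ℂ] HilbertTensor K ℓ²(J, ℂ)) ∘L x ∘L
            ContinuousLinearMap.adjoint
              (U : HilbertTensor H ℓ²(J, ℂ) →L[ℂ] HilbertTensor K ℓ²(J, ℂ))) ''
          normalSpatialTensor S (matrixSpace J) := by
  obtain ⟨M, hM, hMT, hMS⟩ := hST
  have hMS' : wStarSpan {x : H →L[ℂ] H | ∃ m ∈ adjointSubmodule M, ∃ t ∈ T,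
      ∃ n ∈ adjointSubmodule M, x = m ∘L t ∘L adjoint n} = (S : Set (H →L[ℂ] H)) := by
    rw [← hMS]
    congr 1 with x
    constructor
    · rintro ⟨m, hm, t, ht, n, hn, rfl⟩
      exact ⟨_, hm, t, ht, _, hn, by rw [adjoint_adjoint]⟩
    · rintro ⟨m, hm, t, ht, n, hn, rfl⟩
      exact ⟨adjoint m, by rwa [mem_adjointSubmodule, adjoint_adjoint], t, ht, adjoint n,
        by rwa [mem_adjointSubmodule, adjoint_adjoint], by rw [adjoint_adjoint]⟩
  have hndK : ∀ k, (∀ m ∈ M, adjoint m k = 0) → k = 0 :=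
    eq_zero_of_forall_adjoint_apply_eq_zero (S := S) (by
      have := hT.one_mem
      rwa [← SetLike.mem_coe, ← hMT] at this)
  have hndH : ∀ h, (∀ m ∈ adjointSubmodule M, adjoint m h = 0) → h = 0 :=
    eq_zero_of_forall_adjoint_apply_eq_zero (S := T) (by
      have := hS.one_mem
      rwa [← SetLike.mem_coe, ← hMS'] at this)
  have hmT : ∀ m ∈ M, ∀ s ∈ S, ∀ n ∈ M, m ∘L s ∘L adjoint n ∈ T := fun m hm s hs n hn => by
    rw [← SetLike.mem_coe, ← hMT]
    exact subset_wStarSpan _ ⟨m, hm, s, hs, n, hn, rfl⟩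
  have hmS : ∀ m ∈ adjointSubmodule M, ∀ t ∈ T, ∀ n ∈ adjointSubmodule M,
      m ∘L t ∘L adjoint n ∈ S := fun m hm s hs n hn => by
    rw [← SetLike.mem_coe, ← hMS']
    exact subset_wStarSpan _ ⟨m, hm, s, hs, n, hn, rfl⟩
  -- Prepending a letter to a list injects J × (letters) into J, so J absorbs the index sets of both
  -- columns at once; the empty list makes it nonempty.
  let J : Type (max u v) := List ((ℕ × (H →L[ℂ] K)) ⊕ (ℕ × (K →L[ℂ] H)))
  obtain ⟨A, hA, hAA⟩ := exists_isometric_intertwiner (J := J) (R := linkingCommutant M)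
    adjoint_mem_linkingCommutant (fun h hh => by
      by_contra! hcon
      -- Elements of M are themselves intertwiners, so a vector killed by all intertwiners is killed
      -- by M.
      exact hh (hndH h fun m hm => hcon _ fun p hp => (hp _ hm).1))
    (e := fun p => Sum.inl p.2 :: p.1) (fun p q h => by
      have h' := List.cons.inj h
      exact Prod.ext h'.2 (Sum.inl.inj h'.1))
  obtain ⟨B, hB, hBB⟩ := exists_isometric_intertwiner (J := J)
    (R := linkingCommutant (adjointSubmodule M))
    adjoint_mem_linkingCommutant (fun h hh => by
      by_contra! hcon
      exact hh (hndK h fun m hm => hcon _ fun p hp =>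
        (hp _ (by rwa [mem_adjointSubmodule, adjoint_adjoint])).1))
    (e := fun p => Sum.inr p.2 :: p.1) (fun p q h => by
      have h' := List.cons.inj h
      exact Prod.ext h'.2 (Sum.inr.inj h'.1))
  obtain ⟨U, hU, hUU, hUU'⟩ := exists_unitary_intertwiner
    (R := (fun p : (H →L[ℂ] H) × (K →L[ℂ] K) => (ampliation J p.1, ampliation J p.2)) ''
      linkingCommutant M)
    (by
      rintro _ ⟨p, hp, rfl⟩
      exact ⟨_, adjoint_mem_linkingCommutant p hp, by simp only [adjoint_ampliation]⟩)
    (A := A) (by rintro _ ⟨p, hp, rfl⟩; exact hA p hp) hAA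
    (B := B) (by rintro _ ⟨p, hp, rfl⟩; exact hB _ (swap_mem_linkingCommutant_adjointSubmodule hp)) hBB
  have hU : ∀ p ∈ linkingCommutant M, U ∘L ampliation J p.1 = ampliation J p.2 ∘L U :=
    fun p hp => hU _ ⟨p, hp, rfl⟩
  have hU' : ∀ p ∈ linkingCommutant M,
      adjoint U ∘L ampliation J p.2 = ampliation J p.1 ∘L adjoint U := fun p hp =>
    adjoint_intertwines (by
      simpa only [adjoint_ampliation] using hU _ (adjoint_mem_linkingCommutant p hp))
  obtain ⟨ΘH, hΘH⟩ := exists_hilbertTensor_equiv J H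
  obtain ⟨ΘK, hΘK⟩ := exists_hilbertTensor_equiv J K
  let tH : HilbertTensor H ℓ²(J, ℂ) →L[ℂ] ℓ²(J, H) := ΘH
  let tK : HilbertTensor K ℓ²(J, ℂ) →L[ℂ] ℓ²(J, K) := ΘK
  have htH : adjoint tH ∘L tH = ContinuousLinearMap.id ℂ _ :=
    (ContinuousLinearMap.norm_map_iff_adjoint_comp_self _).1 ΘH.norm_map
  have htK : adjoint tK ∘L tK = ContinuousLinearMap.id ℂ _ :=
    (ContinuousLinearMap.norm_map_iff_adjoint_comp_self _).1 ΘK.norm_map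
  have htH' : tH ∘L adjoint tH = ContinuousLinearMap.id ℂ _ := by
    rw [LinearIsometryEquiv.adjoint_eq_symm]
    ext1 f
    exact ΘH.apply_symm_apply f
  have htK' : tK ∘L adjoint tK = ContinuousLinearMap.id ℂ _ := by
    rw [LinearIsometryEquiv.adjoint_eq_symm]
    ext1 f
    exact ΘK.apply_symm_apply f
  have hUnorm : ∀ f, ‖U f‖ = ‖f‖ := (ContinuousLinearMap.norm_map_iff_adjoint_comp_self _).2 hUU
  let U₀ : ℓ²(J, H) ≃ₗᵢ[ℂ] ℓ²(J, K) := LinearIsometryEquiv.ofSurjective ⟨U.toLinearMap, hUnorm⟩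
    fun f => ⟨adjoint U f, congr($hUU' f)⟩
  let W := ΘH.trans (U₀.trans ΘK.symm)
  have hW : (W : HilbertTensor H ℓ²(J, ℂ) →L[ℂ] HilbertTensor K ℓ²(J, ℂ)) =
      adjoint tK ∘L U ∘L tH := by
    rw [LinearIsometryEquiv.adjoint_eq_symm]
    rfl
  refine ⟨J, ⟨[]⟩, W, ?_⟩
  rw [hW]
  ext y
  constructor
  · intro hy
    -- The preimage of y is its conjugate by the adjoint unitary; it lies in the space of S by the
    -- same lemma with M* and U* in place of M and U.
    have h := conj_mem_normalSpatialTensor hM.adjointSubmodule hndH hT.wStarClosed hS.wStarClosed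
      hmS htK hΘK htH htH' hΘH (U := adjoint U) (fun p hp => by
        rw [adjoint_adjoint]
        exact hU _ (swap_mem_linkingCommutant hp)) hy
    refine ⟨_, h, ?_⟩
    have e2 (f) : adjoint tK (tK f) = f := congr($htK f)
    have e3 (f) : tH (adjoint tH f) = f := congr($htH' f)
    have e4 (f) : U (adjoint U f) = f := congr($hUU' f)
    ext f
    simp only [adjoint_comp, adjoint_adjoint, comp_apply, e2, e3, e4]
  · rintro ⟨x, hx, rfl⟩
    exact conj_mem_normalSpatialTensor hM hndK hS.wStarClosed hT.wStarClosed hmT htH hΘH htK htK'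
      hΘK hU' hx
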